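/- Let $c$, $k$ and $t$ be positive integers with $c\ge 3$ and $k\ge t+2$, and assume that $c\ge 3+2\log_2 t$ or $k\ge 2t+2$. A $c$-uniform partition of $[ck]=\{1,2,\dots,ck\}$ is a partition of $[ck]$ into $k$ blocks, each of size $c$; let $\mathcal U$ be the set of all of them, and for $A,B\in\mathcal U$ let $A\cap B$ be the set of blocks that $A$ and $B$ have in common. Two families $\mathcal F,\mathcal G\subseteq\mathcal U$ are cross $t$-intersecting if $|A\cap B|\ge t$ for all $A\in\mathcal F$ and $B\in\mathcal G$. Suppose that $\mathcal F,\mathcal G\subseteq\mathcal U$ are non-empty and cross $t$-intersecting, that $|\mathcal F|\le|\mathcal G|$, and that $|\mathcal F|+|\mathcal G|$ is maximum among all pairs of non-empty cross $t$-intersecting subfamilies of $\mathcal U$. Then there is $C\in\mathcal U$ such that $$\mathcal F=\{C\}\qquad\text{and}\qquad \mathcal G=\{A\in\mathcal U: |A\cap C|\ge t\}.$$ -/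

import Mathlib

/-- `U^{[ck]}_{c,l}`: the set of all families consisting of `l` pairwise disjoint `c`-subsets of a
fixed set with `c * k` elements. For `l = k` its members are (the block sets of) the `c`-uniform
partitions, see `mem_blockFamilies_iff_finpartition`. -/
def blockFamilies (c k l : ℕ) : Finset (Finset (Finset (Fin (c * k)))) :=
  Finset.univ.filter fun P =>
    P.card = l ∧ (∀ b ∈ P, b.card = c) ∧ ∀ b ∈ P, ∀ b' ∈ P, b ≠ b' → Disjoint b b'

/-- The set of all `c`-uniform partitions of a `c * k`-element set into `k` blocks. -/
abbrev uniformPartitions (c k : ℕ) : Finset (Finset (Finset (Fin (c * k)))) :=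
  blockFamilies c k k

/-- `k` pairwise disjoint `c`-subsets of a `c * k`-set are the same thing as the blocks of a
partition of that set into `k` blocks of size `c`. -/
theorem mem_blockFamilies_iff_finpartition {c k : ℕ} (hc : 0 < c)
    (P : Finset (Finset (Fin (c * k)))) :
    P ∈ uniformPartitions c k ↔
      ∃ Q : Finpartition (Finset.univ : Finset (Fin (c * k))),
        Q.parts = P ∧ Q.parts.card = k ∧ ∀ b ∈ Q.parts, b.card = c := by
  simp only [uniformPartitions, blockFamilies, Finset.mem_filter, Finset.mem_univ, true_and]
  constructor
  · rintro ⟨h1, h2, h3⟩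
    refine ⟨⟨P, ?_, ?_, ?_⟩, rfl, h1, h2⟩
    · rw [Finset.supIndep_iff_pairwiseDisjoint]
      intro b hb b' hb' hne
      exact h3 b hb b' hb' hne
    · rw [Finset.sup_eq_biUnion]
      apply Finset.eq_univ_of_card
      rw [Finset.card_biUnion (t := id) (fun b hb b' hb' hne => h3 b hb b' hb' hne)]
      simp only [id]
      rw [Finset.sum_congr rfl h2]
      simp [h1, mul_comm]
    · intro h
      have := h2 _ h
      simp at this
      omega
  · rintro ⟨Q, rfl, h1, h2⟩
    exact ⟨h1, h2, fun b hb b' hb' hne => Q.disjoint hb hb' hne⟩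

/-- Two families (of families of blocks) are cross `t`-intersecting if members from different
families always have at least `t` blocks in common. -/
def CrossIntersecting {n : ℕ} (t : ℕ) (F G : Finset (Finset (Finset (Fin n)))) : Prop :=
  ∀ A ∈ F, ∀ B ∈ G, t ≤ (A ∩ B).card

/-!
The partitions that share at least `t` blocks with a fixed `C` form a family `H_C`, and the pair
`({C}, H_C)` is cross `t`-intersecting. If `F = {C}`, then `G ⊆ H_C`, and maximality gives equality.
So it is enough to rule out `2 ≤ |F|`, which `card_add_card_le_of_one_lt_card` does: it shows
`|F| + |G| ≤ |H_A|` for `A ∈ F`, one less than the value at `({A}, H_A)`.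

Suppose `2 ≤ |F| ≤ |G|` and `|F| + |G| > |H_A|`. For each `B ∈ F` the family `G` is contained in
`H_A ∩ H_B`, and `2 |G| > |H_A|`. If `A` and `B` share at most `t` blocks, then
`2 |H_A ∩ H_B| ≤ |H_A|` (`two_mul_card_filter_inter_inter_le`), which is impossible. Hence every
member of `F` shares at least `t + 1` blocks with `A`. But there are few such partitions: for any
`B ≠ A` they can be added to `H_A ∩ H_B` without exceeding `|H_A|`
(`card_filter_inter_inter_add_le`), and this bounds `|F| + |G|` by `|H_A|`.

Both inequalities come from counting. The number `q m` of partitions of a `c * m`-set satisfies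
`q (m + 1) = R * q m`, where `R` is a binomial coefficient of size at least quadratic in `m`.
With `k = t + n + 2`, the second Bonferroni inequality bounds `|H_A|` from below by
`k.choose t * q (n + 2) - t * k.choose (t + 1) * q (n + 1)` (`le_card_filter_le_inter`). A partition
in `H_A ∩ H_B` either contains `t` common blocks of `A` and `B`, or contains `t` blocks of `A` and a
further block of `B`, disjoint from them; there are at most `n + 2` choices for the latter
(`card_filter_inter_inter_le`). What remains are inequalities between binomial coefficients
(`half_estimate` and `gap_estimate`).
-/

/-! ### Counting uniform partitions -/

/-- The partitions of the finite set `s` into blocks of size `c`, each given by its set of blocks.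
The number of blocks is not prescribed; it is `s.card / c` when the set of partitions is nonempty and
`0 < c`. -/
def blockPartitions {α : Type*} [DecidableEq α] (c : ℕ) (s : Finset α) :
    Finset (Finset (Finset α)) :=
  s.powerset.powerset.filter fun P =>
    (∀ b ∈ P, b.card = c) ∧ (∀ b ∈ P, ∀ b' ∈ P, b ≠ b' → Disjoint b b') ∧ P.biUnion id = s

/-- The number of partitions of a set with `c * m` elements into blocks of size `c`, given for
`0 < c` by the recursion which chooses the other `c - 1` elements of the block of a fixed point. -/
def partitionCount (c : ℕ) : ℕ → ℕ
  | 0 => 1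
  | m + 1 => (c * (m + 1) - 1).choose (c - 1) * partitionCount c m

section Counting

variable {α : Type*} [DecidableEq α] {c k : ℕ} {s : Finset α} {A B P : Finset (Finset α)}

theorem mem_blockPartitions : P ∈ blockPartitions c s ↔
    (∀ b ∈ P, b.card = c) ∧ (∀ b ∈ P, ∀ b' ∈ P, b ≠ b' → Disjoint b b') ∧
      P.biUnion id = s := by
  simp only [blockPartitions, Finset.mem_filter, Finset.mem_powerset, and_iff_right_iff_imp]
  rintro ⟨-, -, rfl⟩ b hb
  exact Finset.mem_powerset.2 (Finset.subset_biUnion_of_mem id hb)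

theorem card_biUnion_blocks (h1 : ∀ b ∈ P, b.card = c)
    (h2 : ∀ b ∈ P, ∀ b' ∈ P, b ≠ b' → Disjoint b b') :
    (P.biUnion id).card = c * P.card := by
  rw [Finset.card_biUnion (t := id) (fun b hb b' hb' hne => h2 b hb b' hb' hne)]
  simp only [id]
  rw [Finset.sum_congr rfl h1]
  simp [mul_comm]

theorem card_of_mem_blockPartitions (hc : 0 < c) (hs : s.card = c * k)
    (hA : A ∈ blockPartitions c s) : A.card = k := by
  obtain ⟨h1, h2, h3⟩ := mem_blockPartitions.1 hA
  have := card_biUnion_blocks h1 h2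
  rw [h3, hs] at this
  exact (Nat.eq_of_mul_eq_mul_left hc this).symm

/-- Removing the blocks of `P` is a bijection from the partitions of `s` which contain `P` to the
partitions of what `P` leaves uncovered. -/
theorem card_superfamilies (hc : 0 < c) (h1 : ∀ b ∈ P, b.card = c)
    (h2 : ∀ b ∈ P, ∀ b' ∈ P, b ≠ b' → Disjoint b b') (h3 : P.biUnion id ⊆ s) :
    ((blockPartitions c s).filter (P ⊆ ·)).card =
      (blockPartitions c (s \ P.biUnion id)).card := by
  have hd : ∀ Q ∈ blockPartitions c (s \ P.biUnion id), ∀ b ∈ P, ∀ b' ∈ Q, Disjoint b b' := by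
    intro Q hQ b hb b' hb'
    obtain ⟨-, -, q3⟩ := mem_blockPartitions.1 hQ
    have hb'' : b' ⊆ s \ P.biUnion id := q3 ▸ Finset.subset_biUnion_of_mem id hb'
    exact Finset.disjoint_of_subset_left (Finset.subset_biUnion_of_mem id hb)
      (Finset.disjoint_of_subset_right hb'' Finset.disjoint_sdiff)
  have hPQ : ∀ Q ∈ blockPartitions c (s \ P.biUnion id), Disjoint P Q := by
    intro Q hQ
    rw [Finset.disjoint_left]
    intro b hb hb'
    have := h1 b hb
    rw [(Finset.disjoint_self_iff_empty _).1 (hd Q hQ b hb b hb')] at this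
    simp at this
    omega
  refine Finset.card_bij' (fun B _ => B \ P) (fun Q _ => P ∪ Q) ?_ ?_ ?_ ?_
  · intro B hB
    obtain ⟨hB, hPB⟩ := Finset.mem_filter.1 hB
    obtain ⟨b1, b2, b3⟩ := mem_blockPartitions.1 hB
    refine mem_blockPartitions.2 ⟨fun b hb => b1 b (Finset.sdiff_subset hb),
      fun b hb b' hb' => b2 b (Finset.sdiff_subset hb) b' (Finset.sdiff_subset hb'), ?_⟩
    ext x
    simp only [Finset.mem_biUnion, Finset.mem_sdiff, id, ← b3]
    constructor
    · rintro ⟨b, ⟨hb, hbP⟩, hx⟩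
      refine ⟨⟨b, hb, hx⟩, ?_⟩
      rintro ⟨b', hb', hx'⟩
      have hne : b ≠ b' := fun h => hbP (h ▸ hb')
      exact Finset.disjoint_left.1 (b2 b hb b' (hPB hb') hne) hx hx'
    · rintro ⟨⟨b, hb, hx⟩, hn⟩
      exact ⟨b, ⟨hb, fun hbP => hn ⟨b, hbP, hx⟩⟩, hx⟩
  · intro Q hQ
    obtain ⟨q1, q2, q3⟩ := mem_blockPartitions.1 hQ
    refine Finset.mem_filter.2 ⟨mem_blockPartitions.2 ⟨?_, ?_, ?_⟩, Finset.subset_union_left⟩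
    · intro b hb
      rcases Finset.mem_union.1 hb with hb | hb
      exacts [h1 b hb, q1 b hb]
    · intro b hb b' hb' hne
      rcases Finset.mem_union.1 hb with hb | hb <;> rcases Finset.mem_union.1 hb' with hb' | hb'
      · exact h2 b hb b' hb' hne
      · exact hd Q hQ b hb b' hb'
      · exact (hd Q hQ b' hb' b hb).symm
      · exact q2 b hb b' hb' hne
    · rw [Finset.union_biUnion, q3, Finset.union_sdiff_of_subset h3]
  · intro B hB
    exact Finset.union_sdiff_of_subset (Finset.mem_filter.1 hB).2
  · intro Q hQ
    exact Finset.union_sdiff_cancel_left (hPQ Q hQ)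

theorem card_blockPartitions (hc : 0 < c) (m : ℕ) :
    ∀ s : Finset α, s.card = c * m → (blockPartitions c s).card = partitionCount c m := by
  induction m with
  | zero =>
    intro s hs
    have hs : s = ∅ := by simpa using hs
    subst hs
    rw [partitionCount, Finset.card_eq_one]
    refine ⟨∅, ?_⟩
    ext P
    rw [mem_blockPartitions, Finset.mem_singleton]
    constructor
    · rintro ⟨h1, h2, h3⟩
      have := card_biUnion_blocks h1 h2
      rw [h3] at this
      simp at this
      rcases this with h | h
      · omega
      · exact h
    · rintro rfl
      simp
  | succ m ih =>
    intro s hs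
    obtain ⟨x, hx⟩ : s.Nonempty := by
      rw [← Finset.card_pos, hs]
      positivity
    -- Split according to the block `b` which contains `x`.
    have hdecomp : blockPartitions c s =
        (((s.erase x).powersetCard (c - 1)).image (insert x)).biUnion
          fun b => (blockPartitions c s).filter ({b} ⊆ ·) := by
      ext P
      simp only [Finset.mem_biUnion, Finset.mem_filter, Finset.singleton_subset_iff]
      constructor
      · intro hP
        obtain ⟨h1, h2, h3⟩ := mem_blockPartitions.1 hP
        obtain ⟨b, hb, hxb⟩ := Finset.mem_biUnion.1 (h3.symm ▸ hx)
        refine ⟨b, Finset.mem_image.2 ⟨b.erase x, Finset.mem_powersetCard.2 ⟨?_, ?_⟩,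
          Finset.insert_erase hxb⟩, hP, hb⟩
        · exact Finset.erase_subset_erase x (h3 ▸ Finset.subset_biUnion_of_mem id hb)
        · rw [id] at hxb
          rw [Finset.card_erase_of_mem hxb, h1 b hb]
      · rintro ⟨b, -, hP, -⟩
        exact hP
    have hinj : Set.InjOn (insert x)
        (((s.erase x).powersetCard (c - 1) : Finset _) : Set (Finset α)) := by
      intro u hu v hv huv
      have hu := (Finset.mem_powersetCard.1 hu).1
      have hv := (Finset.mem_powersetCard.1 hv).1
      rw [← Finset.erase_insert (fun h => by simpa using hu h : x ∉ u),
        ← Finset.erase_insert (fun h => by simpa using hv h : x ∉ v)]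
      exact congrArg (Finset.erase · x) huv
    rw [hdecomp, Finset.card_biUnion]
    · rw [Finset.sum_congr rfl (g := fun _ => partitionCount c m), Finset.sum_const,
        Finset.card_image_of_injOn hinj, Finset.card_powersetCard, Finset.card_erase_of_mem hx, hs,
        partitionCount, smul_eq_mul]
      intro b hb
      obtain ⟨u, hu, rfl⟩ := Finset.mem_image.1 hb
      obtain ⟨hus, huc⟩ := Finset.mem_powersetCard.1 hu
      have hxu : x ∉ u := fun h => by simpa using hus h
      have hcard : (insert x u).card = c := by rw [Finset.card_insert_of_notMem hxu]; omega
      have hsub : insert x u ⊆ s :=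
        Finset.insert_subset hx (hus.trans (Finset.erase_subset x s))
      rw [card_superfamilies hc (by simpa using hcard) (by simp) (by simpa using hsub)]
      apply ih
      rw [Finset.singleton_biUnion, id, Finset.card_sdiff_of_subset hsub, hs, hcard, mul_add,
        mul_one, Nat.add_sub_cancel]
    · intro b hb b' hb' hne
      rw [Function.onFun, Finset.disjoint_left]
      intro P hP hP'
      obtain ⟨u, -, rfl⟩ := Finset.mem_image.1 hb
      obtain ⟨v, -, rfl⟩ := Finset.mem_image.1 hb'
      simp only [Finset.mem_filter, Finset.singleton_subset_iff] at hP hP'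
      exact Finset.disjoint_left.1 ((mem_blockPartitions.1 hP.1).2.1 _ hP.2 _ hP'.2 hne)
        (Finset.mem_insert_self x u) (Finset.mem_insert_self x v)

theorem card_filter_superset (hc : 0 < c) (hs : s.card = c * k) (hA : A ∈ blockPartitions c s)
    (hP : P ⊆ A) :
    ((blockPartitions c s).filter (P ⊆ ·)).card = partitionCount c (k - P.card) := by
  obtain ⟨h1, h2, h3⟩ := mem_blockPartitions.1 hA
  have hsub : P.biUnion id ⊆ s := h3 ▸ Finset.biUnion_subset_biUnion_of_subset_left id hP
  have g1 : ∀ b ∈ P, b.card = c := fun b hb => h1 b (hP hb)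
  have g2 : ∀ b ∈ P, ∀ b' ∈ P, b ≠ b' → Disjoint b b' :=
    fun b hb b' hb' => h2 b (hP hb) b' (hP hb')
  rw [card_superfamilies hc g1 g2 hsub]
  apply card_blockPartitions hc
  rw [Finset.card_sdiff_of_subset hsub, hs, card_biUnion_blocks g1 g2, Nat.mul_sub]

/-- Here `P` is arbitrary: if it is not a subfamily of some partition, the left side is zero. -/
theorem card_filter_superset_le (hc : 0 < c) (hs : s.card = c * k) (P : Finset (Finset α)) :
    ((blockPartitions c s).filter (P ⊆ ·)).card ≤ partitionCount c (k - P.card) := by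
  rcases ((blockPartitions c s).filter (P ⊆ ·)).eq_empty_or_nonempty with h | ⟨A, hA⟩
  · simp [h]
  · obtain ⟨hA, hP⟩ := Finset.mem_filter.1 hA
    exact (card_filter_superset hc hs hA hP).le

/-- Distinct partitions differ in at least two blocks, because all blocks but one
determine the last. -/
theorem card_inter_add_two_le (hc : 0 < c) (hs : s.card = c * k) (hA : A ∈ blockPartitions c s)
    (hB : B ∈ blockPartitions c s) (hne : A ≠ B) : (A ∩ B).card + 2 ≤ k := by
  by_contra hlt
  have h := card_filter_superset_le hc hs (A ∩ B)
  have hone : partitionCount c (k - (A ∩ B).card) = 1 := by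
    have : k - (A ∩ B).card = 0 ∨ k - (A ∩ B).card = 1 := by omega
    rcases this with h | h <;> simp [h, partitionCount]
  rw [hone, Finset.card_le_one] at h
  exact hne (h A (by simp [hA, Finset.inter_subset_left]) B
    (by simp [hB, Finset.inter_subset_right]))

/-! ### Partitions sharing many blocks with given ones -/

theorem card_filter_le_inter_le (hc : 0 < c) (hs : s.card = c * k) (hA : A ∈ blockPartitions c s)
    (j : ℕ) :
    ((blockPartitions c s).filter fun B => j ≤ (B ∩ A).card).card ≤
      k.choose j * partitionCount c (k - j) := by
  have hsub : ((blockPartitions c s).filter fun B => j ≤ (B ∩ A).card) ⊆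
      (A.powersetCard j).biUnion fun T => (blockPartitions c s).filter (T ⊆ ·) := by
    intro B hB
    obtain ⟨hB, hj⟩ := Finset.mem_filter.1 hB
    obtain ⟨T, hT, hTj⟩ := Finset.exists_subset_card_eq hj
    exact Finset.mem_biUnion.2 ⟨T, Finset.mem_powersetCard.2
      ⟨hT.trans Finset.inter_subset_right, hTj⟩,
      Finset.mem_filter.2 ⟨hB, hT.trans Finset.inter_subset_left⟩⟩
  refine (Finset.card_le_card hsub).trans ?_
  rw [← card_of_mem_blockPartitions hc hs hA, ← Finset.card_powersetCard j A,
    card_of_mem_blockPartitions hc hs hA]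
  refine Finset.card_biUnion_le_card_mul _ _ _ fun T hT => ?_
  rw [← (Finset.mem_powersetCard.1 hT).2]
  exact card_filter_superset_le hc hs T

/-- Double counting of the pairs `(B, T)` with `T` a set of `j` common blocks of `A` and `B`. -/
theorem sum_choose_card_inter (hc : 0 < c) (hs : s.card = c * k) (hA : A ∈ blockPartitions c s)
    (j : ℕ) :
    ∑ B ∈ blockPartitions c s, (B ∩ A).card.choose j = k.choose j * partitionCount c (k - j) := by
  have h := Finset.sum_card_bipartiteAbove_eq_sum_card_bipartiteBelow
    (s := blockPartitions c s) (t := A.powersetCard j) (fun B T => T ⊆ B)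
  have h1 : ∀ B ∈ blockPartitions c s,
      ((A.powersetCard j).bipartiteAbove (fun B T => T ⊆ B) B).card =
        (B ∩ A).card.choose j := by
    intro B _
    rw [← Finset.card_powersetCard]
    congr 1
    ext T
    simp only [Finset.bipartiteAbove, Finset.mem_filter, Finset.mem_powersetCard,
      Finset.subset_inter_iff]
    tauto
  rw [← Finset.sum_congr rfl h1, h, Finset.sum_congr rfl (g := fun _ => partitionCount c (k - j)),
    Finset.sum_const, Finset.card_powersetCard, card_of_mem_blockPartitions hc hs hA, smul_eq_mul]
  intro T hT
  obtain ⟨hTA, hTj⟩ := Finset.mem_powersetCard.1 hT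
  rw [← hTj]
  exact card_filter_superset hc hs hA hTA

/-- The pointwise form of the second Bonferroni inequality for the event that at least `t` of
several events occur. -/
theorem choose_le_ite_add_mul_choose_succ (t x : ℕ) :
    x.choose t ≤ (if t ≤ x then 1 else 0) + t * x.choose (t + 1) := by
  split_ifs with h
  · obtain ⟨y, rfl⟩ := Nat.exists_eq_add_of_le h
    have e := Nat.choose_succ_right_eq (t + y) t
    rw [Nat.add_sub_cancel_left] at e
    rcases y with _ | _ | y
    · simp
    · simp
    · rcases Nat.eq_zero_or_pos t with rfl | ht
      · simp
      · have hle : (t + (y + 1 + 1)).choose t * (t + 1) ≤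
            t * (t + (y + 1 + 1)).choose (t + 1) * (t + 1) := by
          calc _ ≤ (t + (y + 1 + 1)).choose t * (t * (y + 1 + 1)) := by
                gcongr; nlinarith
            _ = t * ((t + (y + 1 + 1)).choose (t + 1) * (t + 1)) := by rw [e]; ring
            _ = _ := by ring
        have := Nat.le_of_mul_le_mul_right hle (Nat.succ_pos t)
        omega
  · simp [Nat.choose_eq_zero_of_lt (not_le.1 h)]

theorem le_card_filter_le_inter (hc : 0 < c) (hs : s.card = c * k) (hA : A ∈ blockPartitions c s)
    (t : ℕ) :
    k.choose t * partitionCount c (k - t) ≤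
      ((blockPartitions c s).filter fun B => t ≤ (B ∩ A).card).card +
        t * (k.choose (t + 1) * partitionCount c (k - (t + 1))) := by
  rw [← sum_choose_card_inter hc hs hA, ← sum_choose_card_inter hc hs hA, Finset.card_filter,
    Finset.mul_sum, ← Finset.sum_add_distrib]
  exact Finset.sum_le_sum fun B _ => choose_le_ite_add_mul_choose_succ t _

/-- The blocks of `B` which are not blocks of `A` and are disjoint from every member of `T`. For
`T ⊆ A`, these are the blocks by which a partition containing `T` can meet `B` outside `A`. -/
def freshBlocks (A B T : Finset (Finset α)) : Finset (Finset α) :=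
  (B \ A).filter fun b => ∀ a ∈ T, Disjoint a b

/-- A partition with at least `t` blocks in common with each of `A` and `B` contains either `t`
common blocks of `A` and `B`, or a set `T` of `t` blocks of `A`, not all in `B`, and a fresh
block of `B`. -/
theorem card_filter_inter_inter_le (hc : 0 < c) (hs : s.card = c * k)
    (hA : A ∈ blockPartitions c s) (t r : ℕ)
    (hr : ∀ T ⊆ A, T.card = t → ¬ T ⊆ B → (freshBlocks A B T).card ≤ r) :
    ((blockPartitions c s).filter fun D => t ≤ (D ∩ A).card ∧ t ≤ (D ∩ B).card).card ≤
      (A ∩ B).card.choose t * partitionCount c (k - t) +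
        k.choose t * (r * partitionCount c (k - (t + 1))) := by
  have hsub : ((blockPartitions c s).filter fun D => t ≤ (D ∩ A).card ∧ t ≤ (D ∩ B).card) ⊆
      (((A ∩ B).powersetCard t).biUnion fun T => (blockPartitions c s).filter (T ⊆ ·)) ∪
      (((A.powersetCard t).filter (¬ · ⊆ B)).biUnion fun T => (freshBlocks A B T).biUnion fun b =>
        (blockPartitions c s).filter (insert b T ⊆ ·)) := by
    intro D hD
    obtain ⟨hD, hDA, hDB⟩ := Finset.mem_filter.1 hD
    obtain ⟨d1, d2, d3⟩ := mem_blockPartitions.1 hD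
    rw [Finset.mem_union]
    by_cases hT : ∃ T ⊆ D ∩ (A ∩ B), T.card = t
    · obtain ⟨T, hT, hTt⟩ := hT
      exact Or.inl (Finset.mem_biUnion.2 ⟨T, Finset.mem_powersetCard.2
        ⟨hT.trans Finset.inter_subset_right, hTt⟩,
        Finset.mem_filter.2 ⟨hD, hT.trans Finset.inter_subset_left⟩⟩)
    · right
      obtain ⟨T, hTDA, hTt⟩ := Finset.exists_subset_card_eq hDA
      have hTD := hTDA.trans Finset.inter_subset_left
      have hTA := hTDA.trans Finset.inter_subset_right
      obtain ⟨b, hbDB, hbA⟩ : ∃ b ∈ D ∩ B, b ∉ A := by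
        by_contra! h
        obtain ⟨T', hT', hTt'⟩ := Finset.exists_subset_card_eq hDB
        exact hT ⟨T', fun b hb => by have := h b (hT' hb); have := hT' hb; simp_all, hTt'⟩
      obtain ⟨hbD, hbB⟩ := Finset.mem_inter.1 hbDB
      refine Finset.mem_biUnion.2 ⟨T, Finset.mem_filter.2 ⟨Finset.mem_powersetCard.2 ⟨hTA, hTt⟩,
        fun hTB => hT ⟨T, Finset.subset_inter hTD (Finset.subset_inter hTA hTB), hTt⟩⟩,
        Finset.mem_biUnion.2 ⟨b, Finset.mem_filter.2 ⟨Finset.mem_sdiff.2 ⟨hbB, hbA⟩, ?_⟩,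
          Finset.mem_filter.2 ⟨hD, Finset.insert_subset hbD hTD⟩⟩⟩
      exact fun a ha => d2 a (hTD ha) b hbD fun h => hbA (h ▸ hTA ha)
  refine (Finset.card_le_card hsub).trans ((Finset.card_union_le _ _).trans (add_le_add ?_ ?_))
  · rw [← Finset.card_powersetCard]
    refine Finset.card_biUnion_le_card_mul _ _ _ fun T hT => ?_
    rw [← (Finset.mem_powersetCard.1 hT).2]
    exact card_filter_superset_le hc hs T
  · refine (Finset.card_biUnion_le_card_mul _ _ (r * partitionCount c (k - (t + 1))) ?_).trans
      (Nat.mul_le_mul_right _ ?_)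
    · intro T hT
      obtain ⟨hT, hTB⟩ := Finset.mem_filter.1 hT
      obtain ⟨hTA, hTt⟩ := Finset.mem_powersetCard.1 hT
      refine (Finset.card_biUnion_le_card_mul _ _ (partitionCount c (k - (t + 1))) ?_).trans
        (Nat.mul_le_mul_right _ (hr T hTA hTt hTB))
      intro b hb
      have hbT : b ∉ T := fun h => (Finset.mem_sdiff.1 (Finset.mem_filter.1 hb).1).2 (hTA h)
      have := card_filter_superset_le hc hs (insert b T)
      rwa [Finset.card_insert_of_notMem hbT, hTt] at this
    · refine (Finset.card_filter_le _ _).trans ?_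
      rw [Finset.card_powersetCard, card_of_mem_blockPartitions hc hs hA]

/-- Fresh blocks are disjoint and lie in the region that `T` leaves uncovered, which has room for
`k - T.card` blocks. -/
theorem card_freshBlocks_le (hc : 0 < c) (hs : s.card = c * k) (hA : A ∈ blockPartitions c s)
    (hB : B ∈ blockPartitions c s) {T : Finset (Finset α)} (hT : T ⊆ A) :
    (freshBlocks A B T).card ≤ k - T.card := by
  obtain ⟨a1, a2, a3⟩ := mem_blockPartitions.1 hA
  obtain ⟨b1, b2, b3⟩ := mem_blockPartitions.1 hB
  have hE : freshBlocks A B T ⊆ B := (Finset.filter_subset _ _).trans Finset.sdiff_subset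
  have e1 := card_biUnion_blocks (P := freshBlocks A B T) (fun b hb => b1 b (hE hb))
    (fun b hb b' hb' => b2 b (hE hb) b' (hE hb'))
  have e2 := card_biUnion_blocks (P := T) (fun b hb => a1 b (hT hb))
    (fun b hb b' hb' => a2 b (hT hb) b' (hT hb'))
  have hTs : T.biUnion id ⊆ s := a3 ▸ Finset.biUnion_subset_biUnion_of_subset_left id hT
  have hEs : (freshBlocks A B T).biUnion id ⊆ s :=
    b3 ▸ Finset.biUnion_subset_biUnion_of_subset_left id hE
  have hdisj : Disjoint (T.biUnion id) ((freshBlocks A B T).biUnion id) := by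
    rw [Finset.disjoint_biUnion_left]
    intro a ha
    rw [Finset.disjoint_biUnion_right]
    intro b hb
    exact (Finset.mem_filter.1 hb).2 a ha
  have := Finset.card_le_card (Finset.union_subset hTs hEs)
  rw [Finset.card_union_of_disjoint hdisj, e1, e2, hs, ← mul_add] at this
  have := Nat.le_of_mul_le_mul_left this hc
  omega

/-- A block `a` which is not in `B` meets at least two blocks of `B`. The gain of one over
`card_freshBlocks_le` is needed for `c = 3`, `k = 3`, `t = 1`. -/
theorem card_freshBlocks_singleton_le (hc : 0 < c) (hs : s.card = c * k)
    (hA : A ∈ blockPartitions c s) (hB : B ∈ blockPartitions c s) {a : Finset α} (ha : a ∈ A)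
    (haB : a ∉ B) : (freshBlocks A B {a}).card ≤ k - 2 := by
  obtain ⟨a1, a2, a3⟩ := mem_blockPartitions.1 hA
  obtain ⟨b1, b2, b3⟩ := mem_blockPartitions.1 hB
  have has : a ⊆ B.biUnion id := b3.symm ▸ a3 ▸ Finset.subset_biUnion_of_mem id ha
  obtain ⟨x, hx⟩ : a.Nonempty := by rw [← Finset.card_pos, a1 a ha]; exact hc
  obtain ⟨b, hb, hxb⟩ := Finset.mem_biUnion.1 (has hx)
  obtain ⟨y, hy, hyb⟩ : ∃ y ∈ a, y ∉ b := by
    by_contra! h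
    have := Finset.eq_of_subset_of_card_le h (by rw [a1 a ha, b1 b hb])
    exact haB (this ▸ hb)
  obtain ⟨b', hb', hyb'⟩ := Finset.mem_biUnion.1 (has hy)
  have hne : b ≠ b' := by rintro rfl; exact hyb hyb'
  have hsub : freshBlocks A B {a} ⊆ B \ {b, b'} := by
    intro d hd
    obtain ⟨hd, hda⟩ := Finset.mem_filter.1 hd
    have hda := Finset.disjoint_left.1 (hda a (Finset.mem_singleton_self a))
    simp only [Finset.mem_sdiff, Finset.mem_insert, Finset.mem_singleton]
    refine ⟨(Finset.mem_sdiff.1 hd).1, ?_⟩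
    rintro (rfl | rfl)
    exacts [hda hx hxb, hda hy hyb']
  refine (Finset.card_le_card hsub).trans ?_
  rw [Finset.card_sdiff_of_subset (Finset.insert_subset hb (Finset.singleton_subset_iff.2 hb')),
    card_of_mem_blockPartitions hc hs hB, Finset.card_pair hne]

end Counting

/-! ### Binomial estimates -/

section Estimates

theorem choose_two_le_choose {c m : ℕ} (hc : 3 ≤ c) (hm : 2 ≤ m) :
    (3 * m - 1).choose 2 ≤ (c * m - 1).choose (c - 1) := by
  -- `c - 1` is at most half of `c * m - 1`, and binomial coefficients increase up to the middle.
  have hhalf : ∀ r, 2 ≤ r → 2 * r ≤ c * m - 1 → (c * m - 1).choose 2 ≤ (c * m - 1).choose r := by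
    intro r hr
    induction r, hr using Nat.le_induction with
    | base => exact fun _ => le_rfl
    | succ r hr ih =>
      intro h
      exact (ih (by omega)).trans (Nat.choose_le_succ_of_lt_half_left (by omega))
  have h2 : c * 2 ≤ c * m := Nat.mul_le_mul_left c hm
  have h3 : 3 * m ≤ c * m := Nat.mul_le_mul_right m hc
  exact (Nat.choose_le_choose 2 (by omega)).trans (hhalf (c - 1) (by omega) (by omega))

/-- The quotient of consecutive values of `partitionCount c` is smallest for `c = 3`. -/
theorem mul_le_two_mul_choose {c : ℕ} (hc : 3 ≤ c) (n : ℕ) :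
    (3 * n + 5) * (3 * n + 4) ≤ 2 * (c * (n + 2) - 1).choose (c - 1) := by
  have h := choose_two_le_choose hc (Nat.le_add_left 2 n)
  have e : 3 * (n + 2) - 1 = (3 * n + 4) + 1 := by omega
  have := Nat.add_one_mul_choose_eq (3 * n + 4) 1
  rw [e] at h
  rw [Nat.choose_one_right] at this
  nlinarith

/-- The numerical content of `two_mul_card_filter_inter_inter_le`, with `R` the quotient of
consecutive values of `partitionCount`. For `t = 1` the factor `n + 1` in place of `n + 2` is needed
because `(t + n + 2).choose t` can be as small as `3`; for `t ≥ 2` it is at least `6`. -/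
theorem half_estimate {n t R : ℕ} (ht : 1 ≤ t) (hR : (3 * n + 5) * (3 * n + 4) ≤ 2 * R) :
    2 * (R + (t + n + 2).choose t * (if t = 1 then n + 1 else n + 2)) +
      t * (t + n + 2).choose (t + 1) ≤ (t + n + 2).choose t * R := by
  have hS := Nat.choose_succ_right_eq (t + n + 2) t
  rw [show t + n + 2 - t = n + 2 by omega] at hS
  split_ifs with h1
  · subst h1
    rw [Nat.choose_one_right] at hS ⊢
    nlinarith
  · have hK : 6 ≤ (t + n + 2).choose t := by
      calc 6 = (2 + 2).choose 2 := by decide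
        _ ≤ (t + 2).choose 2 := Nat.choose_le_choose 2 (by omega)
        _ = (t + 2).choose t := Nat.choose_symm_add.symm
        _ ≤ _ := Nat.choose_le_choose t (by omega)
    have h9 : 9 * (n + 2) ≤ 2 * R := by nlinarith
    have := Nat.mul_le_mul_left ((t + n + 2).choose t) h9
    have := Nat.mul_le_mul_right R hK
    nlinarith

/-- The numerical content of `card_filter_inter_inter_add_le`, with `R` the quotient of consecutive
values of `partitionCount`. -/
theorem gap_estimate {n t R : ℕ} (ht : 1 ≤ t) (hR : (3 * n + 5) * (3 * n + 4) ≤ 2 * R) :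
    (t + n).choose t * R + (t + n + 2).choose t * (n + 2) +
      (t + n + 2).choose (t + 1) + t * (t + n + 2).choose (t + 1) ≤ (t + n + 2).choose t * R := by
  have hS := Nat.choose_succ_right_eq (t + n + 2) t
  rw [show t + n + 2 - t = n + 2 by omega] at hS
  have e1 := Nat.choose_mul_succ_eq (t + n) t
  have e2 := Nat.choose_mul_succ_eq (t + n + 1) t
  rw [show t + n + 1 - t = n + 1 by omega] at e1
  rw [show t + n + 1 + 1 - t = n + 2 by omega, show t + n + 1 + 1 = t + n + 2 by omega] at e2
  set K := (t + n + 2).choose t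
  set K' := (t + n).choose t
  have e3 : K' * ((t + n + 1) * (t + n + 2)) = K * (n + 1) * (n + 2) := by
    rw [← mul_assoc, e1, mul_right_comm, e2]; ring
  -- `K' / K = (n + 2) (n + 1) / ((t + n + 2) (t + n + 1))` is largest for `t = 1`.
  have h1 : K' * (n + 3) ≤ K * (n + 1) := by
    have : K' * (n + 3) * (n + 2) ≤ K * (n + 1) * (n + 2) := by
      rw [← e3, mul_assoc]
      exact Nat.mul_le_mul_left K' (by nlinarith)
    exact Nat.le_of_mul_le_mul_right this (by omega)
  have h2 : (n + 2) * (n + 3) ≤ R := by nlinarith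
  have h3 := Nat.mul_le_mul_left (2 * K) h2
  have h4 := Nat.mul_le_mul_right R h1
  have : (K' * R + 2 * K * (n + 2)) * (n + 3) ≤ (K * R) * (n + 3) := by nlinarith
  have := Nat.le_of_mul_le_mul_right this (by omega)
  nlinarith

end Estimates

/-! ### Comparing the families of partitions close to given ones -/

section Intersections

variable {α : Type*} [DecidableEq α] {c k t : ℕ} {s : Finset α} {A B : Finset (Finset α)}

/-- If `A` and `B` have at most `t` common blocks, then at most half of the partitions sharing `t`
blocks with `A` also share `t` blocks with `B`. -/
theorem two_mul_card_filter_inter_inter_le (hc : 3 ≤ c) (ht : 1 ≤ t) (hk : t + 2 ≤ k)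
    (hs : s.card = c * k) (hA : A ∈ blockPartitions c s) (hB : B ∈ blockPartitions c s)
    (hAB : (A ∩ B).card ≤ t) :
    2 * ((blockPartitions c s).filter fun D => t ≤ (D ∩ A).card ∧ t ≤ (D ∩ B).card).card ≤
      ((blockPartitions c s).filter fun D => t ≤ (D ∩ A).card).card := by
  have hc0 : 0 < c := by omega
  obtain ⟨n, rfl⟩ : ∃ n, k = t + n + 2 := ⟨k - t - 2, by omega⟩
  have hlow := le_card_filter_le_inter hc0 hs hA t
  have hup := card_filter_inter_inter_le (B := B) hc0 hs hA t (if t = 1 then n + 1 else n + 2) (by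
    intro T hTA hTt hTB
    split_ifs with h1
    · obtain ⟨a, rfl⟩ := Finset.card_eq_one.1 (hTt.trans h1)
      have := card_freshBlocks_singleton_le hc0 hs hA hB (Finset.singleton_subset_iff.1 hTA)
        (fun h => hTB (Finset.singleton_subset_iff.2 h))
      omega
    · have := card_freshBlocks_le hc0 hs hA hB hTA
      omega)
  have hj : (A ∩ B).card.choose t ≤ 1 := by
    simpa using Nat.choose_le_choose t hAB
  rw [show t + n + 2 - t = n + 1 + 1 by omega, show t + n + 2 - (t + 1) = n + 1 by omega,
    partitionCount] at hlow hup
  have hest := Nat.mul_le_mul_right (partitionCount c (n + 1))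
    (half_estimate ht (mul_le_two_mul_choose hc n))
  have hj' := Nat.mul_le_mul_right
    ((c * (n + 1 + 1) - 1).choose (c - 1) * partitionCount c (n + 1)) hj
  rw [show n + 2 = n + 1 + 1 from rfl] at *
  nlinarith

/-- For `A ≠ B`, the partitions which share `t` blocks with `A` but not with `B` are at least as
many as those which share `t + 1` blocks with `A`. -/
theorem card_filter_inter_inter_add_le (hc : 3 ≤ c) (ht : 1 ≤ t) (hk : t + 2 ≤ k)
    (hs : s.card = c * k) (hA : A ∈ blockPartitions c s) (hB : B ∈ blockPartitions c s)
    (hne : A ≠ B) :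
    ((blockPartitions c s).filter fun D => t ≤ (D ∩ A).card ∧ t ≤ (D ∩ B).card).card +
        ((blockPartitions c s).filter fun D => t + 1 ≤ (D ∩ A).card).card ≤
      ((blockPartitions c s).filter fun D => t ≤ (D ∩ A).card).card := by
  have hc0 : 0 < c := by omega
  have hAB := card_inter_add_two_le hc0 hs hA hB hne
  obtain ⟨n, rfl⟩ : ∃ n, k = t + n + 2 := ⟨k - t - 2, by omega⟩
  have hlow := le_card_filter_le_inter hc0 hs hA t
  have hsucc := card_filter_le_inter_le hc0 hs hA (t + 1)
  have hup := card_filter_inter_inter_le (B := B) hc0 hs hA t (n + 2) (by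
    intro T hTA hTt _
    have := card_freshBlocks_le hc0 hs hA hB hTA
    omega)
  have hj : (A ∩ B).card.choose t ≤ (t + n).choose t := Nat.choose_le_choose t (by omega)
  rw [show t + n + 2 - t = n + 1 + 1 by omega, show t + n + 2 - (t + 1) = n + 1 by omega,
    partitionCount] at hlow hup
  rw [show t + n + 2 - (t + 1) = n + 1 by omega] at hsucc
  have hest := Nat.mul_le_mul_right (partitionCount c (n + 1))
    (gap_estimate ht (mul_le_two_mul_choose hc n))
  have hj' := Nat.mul_le_mul_right
    ((c * (n + 1 + 1) - 1).choose (c - 1) * partitionCount c (n + 1)) hj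
  rw [show n + 2 = n + 1 + 1 from rfl] at *
  nlinarith

/-- A cross `t`-intersecting pair whose smaller member has at least two elements has total size
strictly below that of `{A}` and the family of partitions sharing `t` blocks with `A`. -/
theorem card_add_card_le_of_one_lt_card (hc : 3 ≤ c) (ht : 1 ≤ t) (hk : t + 2 ≤ k)
    (hs : s.card = c * k) {F G : Finset (Finset (Finset α))} (hF : F ⊆ blockPartitions c s)
    (hG : G ⊆ blockPartitions c s) (hFG : ∀ A ∈ F, ∀ B ∈ G, t ≤ (A ∩ B).card)
    (hle : F.card ≤ G.card) (hA : A ∈ F) (hcard : 1 < F.card) :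
    F.card + G.card ≤ ((blockPartitions c s).filter fun D => t ≤ (D ∩ A).card).card := by
  have hGsub : ∀ B ∈ F, G ⊆
      (blockPartitions c s).filter fun D => t ≤ (D ∩ A).card ∧ t ≤ (D ∩ B).card := by
    intro B hB D hD
    rw [Finset.mem_filter, Finset.inter_comm D A, Finset.inter_comm D B]
    exact ⟨hG hD, hFG A hA D hD, hFG B hB D hD⟩
  by_contra! hlt
  have hFsub : F ⊆ (blockPartitions c s).filter fun D => t + 1 ≤ (D ∩ A).card := by
    intro B hB
    refine Finset.mem_filter.2 ⟨hF hB, ?_⟩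
    by_contra! h
    have h1 := two_mul_card_filter_inter_inter_le hc ht hk hs (hF hA) (hF hB)
      (by rw [Finset.inter_comm]; omega)
    have h2 := Finset.card_le_card (hGsub B hB)
    omega
  obtain ⟨B, hB, hne⟩ := Finset.exists_mem_ne hcard A
  have h1 := card_filter_inter_inter_add_le hc ht hk hs (hF hA) (hF hB) hne.symm
  have h2 := Finset.card_le_card (hGsub B hB)
  have h3 := Finset.card_le_card hFsub
  omega

end Intersections

/-! ### The extremal pairs -/

theorem uniformPartitions_eq_blockPartitions {c : ℕ} (hc : 0 < c) (k : ℕ) :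
    uniformPartitions c k = blockPartitions c Finset.univ := by
  ext P
  have hcard : (Finset.univ : Finset (Fin (c * k))).card = c * k := by simp
  constructor
  · intro h
    obtain ⟨h0, h1, h2⟩ := (Finset.mem_filter.1 h).2
    refine mem_blockPartitions.2 ⟨h1, h2, Finset.eq_univ_of_card _ ?_⟩
    rw [card_biUnion_blocks h1 h2, h0, Fintype.card_fin]
  · intro h
    obtain ⟨h1, h2, -⟩ := mem_blockPartitions.1 h
    exact Finset.mem_filter.2
      ⟨Finset.mem_univ P, card_of_mem_blockPartitions hc hcard h, h1, h2⟩

theorem theorem1p3 (c k t : ℕ) (ht : 1 ≤ t) (hc : 3 ≤ c) (hk : t + 2 ≤ k)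
    (hct : 3 + 2 * Real.logb 2 (t : ℝ) ≤ (c : ℝ) ∨ 2 * t + 2 ≤ k)
    (F G : Finset (Finset (Finset (Fin (c * k)))))
    (hFU : F ⊆ uniformPartitions c k) (hGU : G ⊆ uniformPartitions c k)
    (hF : F.Nonempty) (hG : G.Nonempty)
    (hFG : CrossIntersecting t F G) (hle : F.card ≤ G.card)
    (hmax : ∀ F' ⊆ uniformPartitions c k, ∀ G' ⊆ uniformPartitions c k,
      F'.Nonempty → G'.Nonempty → CrossIntersecting t F' G' →
        F'.card + G'.card ≤ F.card + G.card) :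
    ∃ C ∈ uniformPartitions c k,
      F = {C} ∧ G = (uniformPartitions c k).filter (fun A => t ≤ (A ∩ C).card) := by
  have hU := uniformPartitions_eq_blockPartitions (show 0 < c by omega) k
  have hcard : (Finset.univ : Finset (Fin (c * k))).card = c * k := by simp
  obtain ⟨C, hC⟩ := hF
  set H := (uniformPartitions c k).filter fun A => t ≤ (A ∩ C).card with hH
  have hmaxC : 1 + H.card ≤ F.card + G.card := by
    have hCH : C ∈ H := by
      have := card_of_mem_blockPartitions (by omega) hcard (hU ▸ hFU hC)
      rw [hH, Finset.mem_filter, Finset.inter_self]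
      exact ⟨hFU hC, by omega⟩
    have := hmax {C} (Finset.singleton_subset_iff.2 (hFU hC)) H (Finset.filter_subset _ _)
      (Finset.singleton_nonempty C) ⟨C, hCH⟩ (by
        intro A hA B hB
        rw [Finset.mem_singleton.1 hA, Finset.inter_comm]
        exact (Finset.mem_filter.1 hB).2)
    rwa [Finset.card_singleton] at this
  have hF1 : F.card = 1 := by
    by_contra h1
    have hpos := Finset.card_pos.2 ⟨C, hC⟩
    have := card_add_card_le_of_one_lt_card hc ht hk hcard (hU ▸ hFU) (hU ▸ hGU) hFG hle hC
      (by omega)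
    rw [← hU, ← hH] at this
    omega
  refine ⟨C, hFU hC, ?_, ?_⟩
  · obtain ⟨D, rfl⟩ := Finset.card_eq_one.1 hF1
    rw [Finset.mem_singleton.1 hC]
  · have hGH : G ⊆ H := by
      intro B hB
      refine Finset.mem_filter.2 ⟨hGU hB, ?_⟩
      rw [Finset.inter_comm]
      exact hFG C hC B hB
    exact Finset.eq_of_subset_of_card_le hGH (show H.card ≤ G.card by omega)
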